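/- Let $D$ be an integral domain with quotient field $K$. Assume that $D$ is a Krull domain, that is: $D_{\mathfrak p}$ is a discrete valuation ring for every height-one prime $\mathfrak p$ of $D$; $D=\bigcap_{\mathfrak p} D_{\mathfrak p}$ inside $K$, where $\mathfrak p$ runs over the height-one primes; and every nonzero element of $D$ lies in only finitely many height-one primes. For a nonzero fractional ideal $I$ of $D$ put $I^{-1}=\{x\in K : xI\subseteq D\}$ and $I_v=(I^{-1})^{-1}$, and call $I$ divisorial if $I=I_v$. The divisorial fractional ideals form an abelian group $\mathrm{Div}(D)$ under the multiplication $(I,J)\mapsto (IJ)_v$, and the invertible fractional ideals form a subgroup of it. Let the local class group $G(D)$ be the quotient of $\mathrm{Div}(D)$ by this subgroup. If $D$ is a $\star$-domain, that is, if $a^2D\cap b^2D=(aD\cap bD)^2$ for all $a,b\in D$, then $G(D)$ has no element of order two. -/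

import Mathlib

open scoped nonZeroDivisors

/-- A Krull domain: the localizations at the height-one primes are discrete valuation rings,
`D` is the intersection of these localizations inside its quotient field, and every nonzero
element lies in only finitely many height-one primes. -/
class IsKrullDomain (D : Type*) [CommRing D] [IsDomain D] : Prop where
  isDiscreteValuationRing : ∀ p : PrimeSpectrum D, p.asIdeal.height = 1 →
    IsDiscreteValuationRing (Localization.AtPrime p.asIdeal)
  iInf_localization_eq_bot :
    (⨅ p : {p : PrimeSpectrum D // p.asIdeal.height = 1},
      Localization.subalgebra.ofField (FractionRing D) p.1.asIdeal.primeCompl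
        p.1.asIdeal.primeCompl_le_nonZeroDivisors) = ⊥
  finite_character : ∀ x : D, x ≠ 0 →
    {p : PrimeSpectrum D | p.asIdeal.height = 1 ∧ x ∈ p.asIdeal}.Finite

/-- A `⋆`-domain: `a²D ∩ b²D = (aD ∩ bD)²` for all `a, b ∈ D`. -/
def IsStarDomain (D : Type*) [CommRing D] [IsDomain D] : Prop :=
  ∀ a b : D, Ideal.span {a ^ 2} ⊓ Ideal.span {b ^ 2} = (Ideal.span {a} ⊓ Ideal.span {b}) ^ 2

section Inverse

variable {D : Type*} [CommRing D] [IsDomain D] {K : Type*} [Field K] [Algebra D K]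
  [IsFractionRing D K]

namespace FractionalIdeal

theorem le_inv_iff_mul_le_one {I J : FractionalIdeal D⁰ K} (hJ : J ≠ 0) :
    I ≤ J⁻¹ ↔ I * J ≤ 1 :=
  le_div_iff_mul_le hJ

theorem inv_ne_zero_of_ne_zero {I : FractionalIdeal D⁰ K} (hI : I ≠ 0) : I⁻¹ ≠ 0 := by
  obtain ⟨a, J, ha, h⟩ := exists_eq_spanSingleton_mul I
  have ha' : algebraMap D K a ≠ 0 := by simpa using ha
  have h1 : spanSingleton D⁰ (algebraMap D K a) ≤ I⁻¹ := by
    rw [le_inv_iff_mul_le_one hI, h, ← mul_assoc, spanSingleton_mul_spanSingleton,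
      mul_inv_cancel₀ ha', spanSingleton_one, one_mul]
    exact coeIdeal_le_one
  intro h0
  rw [h0, le_zero_iff, spanSingleton_eq_zero_iff] at h1
  exact ha' h1

theorem mul_ne_zero_of_ne_zero {I J : FractionalIdeal D⁰ K} (hI : I ≠ 0) (hJ : J ≠ 0) :
    I * J ≠ 0 := by
  obtain ⟨a, ha, haI⟩ := exists_ne_zero_mem_isInteger hI
  obtain ⟨b, hb, hbJ⟩ := exists_ne_zero_mem_isInteger hJ
  intro h
  have h1 := mul_mem_mul haI hbJ
  rw [h, mem_zero_iff, ← map_mul] at h1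
  exact mul_ne_zero ha hb (by simpa using h1)

theorem le_inv_inv {I : FractionalIdeal D⁰ K} (hI : I ≠ 0) : I ≤ I⁻¹⁻¹ := by
  rw [le_inv_iff_mul_le_one (inv_ne_zero_of_ne_zero hI)]
  exact mul_one_div_le_one

theorem inv_inv_inv {I : FractionalIdeal D⁰ K} (hI : I ≠ 0) : I⁻¹⁻¹⁻¹ = I⁻¹ :=
  le_antisymm
    (inv_anti_mono hI (inv_ne_zero_of_ne_zero (inv_ne_zero_of_ne_zero hI)) (le_inv_inv hI))
    (le_inv_inv (inv_ne_zero_of_ne_zero hI))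

theorem inv_mul_inv_inv {I J : FractionalIdeal D⁰ K} (hI : I ≠ 0) (hJ : J ≠ 0) :
    (I * J⁻¹⁻¹)⁻¹ = (I * J)⁻¹ := by
  have hJ' := inv_ne_zero_of_ne_zero (inv_ne_zero_of_ne_zero hJ)
  refine eq_of_forall_le_iff fun A => ?_
  rw [le_inv_iff_mul_le_one (mul_ne_zero_of_ne_zero hI hJ'),
    le_inv_iff_mul_le_one (mul_ne_zero_of_ne_zero hI hJ),
    ← mul_assoc, ← mul_assoc, ← le_inv_iff_mul_le_one hJ', ← le_inv_iff_mul_le_one hJ,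
    inv_inv_inv hJ]

theorem inv_one_eq_one : (1 : FractionalIdeal D⁰ K)⁻¹ = 1 :=
  (right_inverse_eq K 1 1 (one_mul 1)).symm

end FractionalIdeal

end Inverse

section Krull

variable {D : Type*} [CommRing D] [IsDomain D]

theorem IsKrullDomain.dvd_of_forall_pow_dvd [IsKrullDomain D] {a b d : D} (hb : b ≠ 0)
    (hd : d ≠ 0) (h : ∀ n : ℕ, b ^ n ∣ d * a ^ n) : b ∣ a := by
  by_cases ha : a = 0
  · simp [ha]
  have hb' : algebraMap D (FractionRing D) b ≠ 0 := by simpa using hb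
  have key : algebraMap D (FractionRing D) a * (algebraMap D (FractionRing D) b)⁻¹ ∈
      (⊥ : Subalgebra D (FractionRing D)) := by
    rw [← IsKrullDomain.iInf_localization_eq_bot, Algebra.mem_iInf]
    rintro ⟨p, hp⟩
    have := IsKrullDomain.isDiscreteValuationRing p hp
    let f := algebraMap D (Localization.AtPrime p.asIdeal)
    have hf : Function.Injective f :=
      IsLocalization.injective _ p.asIdeal.primeCompl_le_nonZeroDivisors
    have hfa : f a ≠ 0 := by rwa [Ne, map_eq_zero_iff f hf]
    have hfd : f d ≠ 0 := by rwa [Ne, map_eq_zero_iff f hf]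
    have hdvd : f b ∣ f a := by
      rcases ValuationRing.dvd_total (f b) (f a) with h1 | ⟨c, hc⟩
      · exact h1
      by_cases hcu : IsUnit c
      · exact ⟨_, (by rw [hc, mul_assoc, hcu.mul_val_inv, mul_one] :
          f a = f b * (hcu.unit⁻¹ : (Localization.AtPrime p.asIdeal)ˣ))⟩
      · exfalso
        obtain ⟨n, hn⟩ := FiniteMultiplicity.of_not_isUnit hcu hfd
        apply hn
        have h2 := map_dvd f (h (n + 1))
        rw [map_mul, map_pow, map_pow, hc, mul_pow, mul_comm (f d)] at h2
        exact (mul_dvd_mul_iff_left (pow_ne_zero _ hfa)).1 h2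
    obtain ⟨c, hc⟩ := hdvd
    obtain ⟨r, s, rfl⟩ := IsLocalization.exists_mk'_eq p.asIdeal.primeCompl c
    have h3 : a * s = b * r := by
      apply hf
      rw [map_mul, map_mul]
      rw [hc, mul_assoc, IsLocalization.mk'_spec]
    refine ⟨r, s, s.2, ?_⟩
    have hs : algebraMap D (FractionRing D) s ≠ 0 := by
      have : (s : D) ≠ 0 := fun h0 => s.2 (by simp [h0])
      simpa using this
    rw [← div_eq_mul_inv, ← div_eq_mul_inv, div_eq_div_iff hb' hs, ← map_mul, ← map_mul, h3,
      mul_comm]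
  rw [Algebra.mem_bot] at key
  obtain ⟨c, hc⟩ := key
  refine ⟨c, IsFractionRing.injective D (FractionRing D) ?_⟩
  rw [map_mul, hc, mul_comm, mul_assoc, inv_mul_cancel₀ hb', mul_one]

theorem IsKrullDomain.inv_mul_inv_eq_one [IsKrullDomain D] {K : Type*} [Field K] [Algebra D K]
    [IsFractionRing D K] {I : FractionalIdeal D⁰ K} (hI : I ≠ 0) : (I * I⁻¹)⁻¹ = 1 := by
  have hI' := FractionalIdeal.inv_ne_zero_of_ne_zero hI
  have hII := FractionalIdeal.mul_ne_zero_of_ne_zero hI hI'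
  apply le_antisymm
  · intro x hx
    have hstep : ∀ y ∈ I⁻¹, x * y ∈ I⁻¹ := by
      intro y hy
      rw [FractionalIdeal.mem_inv_iff hI]
      intro z hz
      rw [mul_assoc, mul_comm y]
      exact (FractionalIdeal.mem_inv_iff hII).1 hx _ (FractionalIdeal.mul_mem_mul hz hy)
    have hpow : ∀ n : ℕ, ∀ y ∈ I⁻¹, x ^ n * y ∈ I⁻¹ := by
      intro n
      induction n with
      | zero => simp
      | succ n ih => intro y hy; rw [pow_succ', mul_assoc]; exact hstep _ (ih y hy)
    obtain ⟨y, hy, hy0⟩ := FractionalIdeal.exists_ne_zero_mem_isInteger hI'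
    obtain ⟨z, hz, hz0⟩ := FractionalIdeal.exists_ne_zero_mem_isInteger hI
    obtain ⟨a, b, hb, rfl⟩ := IsFractionRing.div_surjective (A := D) x
    have hb0 : algebraMap D K b ≠ 0 := by
      simpa using nonZeroDivisors.ne_zero hb
    have hba : b ∣ a := by
      refine IsKrullDomain.dvd_of_forall_pow_dvd (d := y * z) (nonZeroDivisors.ne_zero hb)
        (mul_ne_zero hy hz) fun n => ?_
      obtain ⟨c, hc⟩ := (FractionalIdeal.mem_one_iff _).1
        ((FractionalIdeal.mem_inv_iff hI).1 (hpow n _ hy0) _ hz0)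
      refine ⟨c, IsFractionRing.injective D K ?_⟩
      simp only [map_mul, map_pow, hc, div_pow]
      field_simp
    obtain ⟨c, rfl⟩ := hba
    rw [FractionalIdeal.mem_one_iff]
    exact ⟨c, by rw [map_mul]; field_simp⟩
  · rw [FractionalIdeal.le_inv_iff_mul_le_one hII, one_mul]
    exact FractionalIdeal.mul_one_div_le_one

end Krull

/-- `Div(D)`: the divisorial fractional ideals of `D`, that is, the nonzero fractional ideals `I`
in the quotient field `K` with `(I⁻¹)⁻¹ = I`, where `I⁻¹ = (D :_K I)`. -/
@[ext]
structure DivisorialIdeal (D : Type*) [CommRing D] [IsDomain D] (K : Type*) [Field K]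
    [Algebra D K] [IsFractionRing D K] where
  val : FractionalIdeal D⁰ K
  ne_zero : val ≠ 0
  inv_inv : val⁻¹⁻¹ = val

namespace DivisorialIdeal

variable {D : Type*} [CommRing D] [IsDomain D] {K : Type*} [Field K] [Algebra D K]
  [IsFractionRing D K]

/-- The divisorial closure `I_v = (I⁻¹)⁻¹` of a nonzero fractional ideal. -/
noncomputable def vClosure (I : FractionalIdeal D⁰ K) (hI : I ≠ 0) : DivisorialIdeal D K where
  val := I⁻¹⁻¹
  ne_zero := FractionalIdeal.inv_ne_zero_of_ne_zero (FractionalIdeal.inv_ne_zero_of_ne_zero hI)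
  inv_inv := FractionalIdeal.inv_inv_inv (FractionalIdeal.inv_ne_zero_of_ne_zero hI)

/-- The `v`-multiplication `(I, J) ↦ (IJ)_v`. -/
noncomputable instance : Mul (DivisorialIdeal D K) where
  mul I J := vClosure (I.val * J.val) (FractionalIdeal.mul_ne_zero_of_ne_zero I.ne_zero J.ne_zero)

noncomputable instance : One (DivisorialIdeal D K) where
  one := ⟨1, one_ne_zero, by
    rw [FractionalIdeal.inv_one_eq_one, FractionalIdeal.inv_one_eq_one]⟩

noncomputable instance : Inv (DivisorialIdeal D K) where
  inv I := ⟨I.val⁻¹, FractionalIdeal.inv_ne_zero_of_ne_zero I.ne_zero,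
    FractionalIdeal.inv_inv_inv I.ne_zero⟩

theorem val_mul (I J : DivisorialIdeal D K) : (I * J).val = (I.val * J.val)⁻¹⁻¹ := rfl

theorem val_one : (1 : DivisorialIdeal D K).val = 1 := rfl

theorem val_inv (I : DivisorialIdeal D K) : (I⁻¹).val = I.val⁻¹ := rfl

protected theorem mul_comm (I J : DivisorialIdeal D K) : I * J = J * I := by
  ext1
  rw [val_mul, val_mul, mul_comm]

protected theorem mul_assoc (I J L : DivisorialIdeal D K) : I * J * L = I * (J * L) := by
  ext1
  rw [val_mul, val_mul, val_mul, val_mul, mul_comm _ L.val,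
    FractionalIdeal.inv_mul_inv_inv L.ne_zero
      (FractionalIdeal.mul_ne_zero_of_ne_zero I.ne_zero J.ne_zero),
    FractionalIdeal.inv_mul_inv_inv I.ne_zero
      (FractionalIdeal.mul_ne_zero_of_ne_zero J.ne_zero L.ne_zero),
    mul_comm L.val, mul_assoc]

protected theorem one_mul (I : DivisorialIdeal D K) : 1 * I = I := by
  ext1
  rw [val_mul, val_one, one_mul, I.inv_inv]

protected theorem inv_mul_cancel [IsKrullDomain D] (I : DivisorialIdeal D K) : I⁻¹ * I = 1 := by
  ext1
  rw [val_mul, val_one, val_inv, mul_comm, IsKrullDomain.inv_mul_inv_eq_one I.ne_zero,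
    FractionalIdeal.inv_one_eq_one]

/-- Over a Krull domain, `Div(D)` is an abelian group under the `v`-multiplication. -/
noncomputable instance [IsKrullDomain D] : CommGroup (DivisorialIdeal D K) where
  mul_assoc := DivisorialIdeal.mul_assoc
  one_mul := DivisorialIdeal.one_mul
  mul_one I := by rw [DivisorialIdeal.mul_comm, DivisorialIdeal.one_mul]
  mul_comm := DivisorialIdeal.mul_comm
  inv_mul_cancel := DivisorialIdeal.inv_mul_cancel

variable (D K) in
/-- The subgroup of `Div(D)` consisting of the invertible fractional ideals. -/
noncomputable def invertible [IsKrullDomain D] : Subgroup (DivisorialIdeal D K) where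
  carrier := {I | IsUnit I.val}
  one_mem' := isUnit_one
  mul_mem' {I J} hI hJ := by
    have h := (FractionalIdeal.mul_inv_cancel_iff_isUnit K).2 (IsUnit.mul hI hJ)
    have h' : (I * J).val = I.val * J.val := by
      rw [val_mul, ← FractionalIdeal.right_inverse_eq K _ _ ((mul_comm _ _).trans h)]
    exact (congrArg IsUnit h').mpr (IsUnit.mul hI hJ)
  inv_mem' {I} hI :=
    IsUnit.of_mul_eq_one I.val
      ((mul_comm _ _).trans ((FractionalIdeal.mul_inv_cancel_iff_isUnit K).2 hI))

end DivisorialIdeal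

/-- Every invertible fractional ideal is divisorial, so `DivisorialIdeal.invertible` really
contains all the invertible fractional ideals. -/
theorem FractionalIdeal.inv_inv_of_isUnit {D : Type*} [CommRing D] [IsDomain D] {K : Type*}
    [Field K] [Algebra D K] [IsFractionRing D K] {I : FractionalIdeal D⁰ K} (hI : IsUnit I) :
    I⁻¹⁻¹ = I :=
  (FractionalIdeal.right_inverse_eq K _ _
    ((mul_comm _ _).trans ((FractionalIdeal.mul_inv_cancel_iff_isUnit K).2 hI))).symm

/-- The local class group `G(D)`: the group `Div(D)` modulo the invertible fractional ideals. -/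
abbrev LocalClassGroup (D : Type*) [CommRing D] [IsDomain D] [IsKrullDomain D] (K : Type*)
    [Field K] [Algebra D K] [IsFractionRing D K] : Type _ :=
  DivisorialIdeal D K ⧸ DivisorialIdeal.invertible D K

/-! ### Approximation at height-one primes -/

section TwoGeneration

variable {D : Type*} [CommRing D] [IsDomain D]

/-! The point is that in a Krull `⋆`-domain the square of a divisorial ideal `I` is already
divisorial. If the class of `I` squares to the identity, then `(I²)_v` is invertible; since it
equals `I²`, its factor `I` is invertible too and the class is trivial. Up to a scalar, `I` is the
inverse of an integral ideal, and approximation at finitely many height-one primes replaces that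
ideal by some `(a, b)` with the same inverse (`exists_inv_coeIdeal_eq_inv_span_pair`). As `(a, b)⁻¹
= (ab)⁻¹(aD ∩ bD)`, the `⋆`-condition says `((a, b)⁻¹)² = (a², b²)⁻¹`. So `I²` is itself an inverse,
and every inverse is divisorial. -/

theorem IsKrullDomain.dvd_of_forall_localization_dvd [IsKrullDomain D] {a b : D} (hb : b ≠ 0)
    (h : ∀ p : PrimeSpectrum D, p.asIdeal.height = 1 →
      algebraMap D (Localization.AtPrime p.asIdeal) b ∣ algebraMap D _ a) : b ∣ a := by
  have hb' : algebraMap D (FractionRing D) b ≠ 0 := by simpa using hb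
  have key : algebraMap D (FractionRing D) a * (algebraMap D (FractionRing D) b)⁻¹ ∈
      (⊥ : Subalgebra D (FractionRing D)) := by
    rw [← IsKrullDomain.iInf_localization_eq_bot, Algebra.mem_iInf]
    rintro ⟨p, hp⟩
    obtain ⟨c, hc⟩ := h p hp
    obtain ⟨r, s, rfl⟩ := IsLocalization.exists_mk'_eq p.asIdeal.primeCompl c
    have h3 : a * s = b * r := by
      apply IsLocalization.injective (Localization.AtPrime p.asIdeal)
        p.asIdeal.primeCompl_le_nonZeroDivisors
      rw [map_mul, map_mul, hc, mul_assoc, IsLocalization.mk'_spec]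
    refine ⟨r, s, s.2, ?_⟩
    have hs : algebraMap D (FractionRing D) s ≠ 0 := by
      have : (s : D) ≠ 0 := fun h0 => s.2 (by simp [h0])
      simpa using this
    rw [← div_eq_mul_inv, ← div_eq_mul_inv, div_eq_div_iff hb' hs, ← map_mul, ← map_mul, h3,
      mul_comm]
  rw [Algebra.mem_bot] at key
  obtain ⟨c, hc⟩ := key
  refine ⟨c, IsFractionRing.injective D (FractionRing D) ?_⟩
  rw [map_mul, hc, mul_comm, mul_assoc, inv_mul_cancel₀ hb', mul_one]

/-- An element of least valuation works; the value `⊤` of zero also covers the case where `f` kills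
`I`. -/
theorem Ideal.exists_mem_forall_map_dvd {R S : Type*} [CommRing R] [CommRing S] [IsDomain S]
    [IsDiscreteValuationRing S] (f : R →+* S) (I : Ideal R) :
    ∃ b ∈ I, ∀ z ∈ I, f b ∣ f z := by
  obtain ⟨b, hb, hmin⟩ := WellFounded.has_min
    (InvImage.wf (fun x : R => IsDiscreteValuationRing.addVal S (f x)) wellFounded_lt)
    (I : Set R) ⟨0, I.zero_mem⟩
  exact ⟨b, hb, fun z hz => IsDiscreteValuationRing.addVal_le_iff_dvd.1 (not_lt.1 (hmin z hz))⟩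

/-- Distinct height-one primes are incomparable, so each `q ≠ p` has an element outside `p`; the
product of these stays outside `p`. -/
theorem PrimeSpectrum.exists_notMem_and_forall_mem_of_height_eq_one {R : Type*}
    [CommRing R] (S : Finset (PrimeSpectrum R)) (hS : ∀ q ∈ S, q.asIdeal.height = 1)
    {p : PrimeSpectrum R} (hp : p.asIdeal.height = 1) :
    ∃ c, c ∉ p.asIdeal ∧ ∀ q ∈ S, q ≠ p → c ∈ q.asIdeal := by
  have hsep : ∀ q : PrimeSpectrum R, ∃ d, d ∉ p.asIdeal ∧ (q ∈ S → q ≠ p → d ∈ q.asIdeal) := by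
    intro q
    by_cases hq : q ∈ S ∧ q ≠ p
    · have hnle : ¬ q.asIdeal ≤ p.asIdeal := by
        intro hle
        have hlt : q.asIdeal < p.asIdeal :=
          lt_of_le_of_ne hle fun h => hq.2 (PrimeSpectrum.ext h)
        have hfin : q.asIdeal.FiniteHeight :=
          ⟨Or.inr (by rw [hS q hq.1]; exact ENat.one_ne_top)⟩
        have := Ideal.height_strict_mono_of_isPrime hlt
        rw [hS q hq.1, hp] at this
        exact lt_irrefl _ this
      obtain ⟨d, hd, hd'⟩ := SetLike.not_le_iff_exists.1 hnle
      exact ⟨d, hd', fun _ _ => hd⟩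
    · exact ⟨1, p.asIdeal.one_notMem, fun h1 h2 => absurd ⟨h1, h2⟩ hq⟩
  choose d hd hd' using hsep
  refine ⟨∏ q ∈ S, d q, ?_, fun q hq hqp => Ideal.prod_mem _ hq (hd' q hq hqp)⟩
  rw [p.2.prod_mem_iff]
  rintro ⟨q, -, hq⟩
  exact hd q hq

/-- An ideal of a Krull domain has a common local generator at finitely many height-one primes. -/
theorem IsKrullDomain.exists_mem_forall_localization_dvd [IsKrullDomain D] (I : Ideal D)
    (S : Finset (PrimeSpectrum D)) (hS : ∀ q ∈ S, q.asIdeal.height = 1) :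
    ∃ b ∈ I, ∀ p ∈ S, ∀ z ∈ I,
      algebraMap D (Localization.AtPrime p.asIdeal) b ∣ algebraMap D _ z := by
  classical
  have hloc : ∀ p : PrimeSpectrum D, ∃ b ∈ I, p ∈ S → ∀ z ∈ I,
      algebraMap D (Localization.AtPrime p.asIdeal) b ∣ algebraMap D _ z := by
    intro p
    by_cases hp : p ∈ S
    · have := IsKrullDomain.isDiscreteValuationRing p (hS p hp)
      obtain ⟨b, hb, h⟩ := I.exists_mem_forall_map_dvd
        (algebraMap D (Localization.AtPrime p.asIdeal))
      exact ⟨b, hb, fun _ => h⟩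
    · exact ⟨0, I.zero_mem, fun h => absurd h hp⟩
  have hsep : ∀ p : PrimeSpectrum D, ∃ c, p ∈ S →
      c ∉ p.asIdeal ∧ ∀ q ∈ S, q ≠ p → c ∈ q.asIdeal := by
    intro p
    by_cases hp : p ∈ S
    · obtain ⟨c, hc⟩ :=
        PrimeSpectrum.exists_notMem_and_forall_mem_of_height_eq_one S hS (hS p hp)
      exact ⟨c, fun _ => hc⟩
    · exact ⟨0, fun h => absurd h hp⟩
  choose b hbI hb using hloc
  choose c hc using hsep
  -- At `p`, every `b q` is a multiple of `b p`, while `c q` is a unit for `q = p` and lies in the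
  -- maximal ideal otherwise. The sum is therefore `b p` times a unit.
  refine ⟨∑ q ∈ S, b q * c q, I.sum_mem fun q _ => I.mul_mem_right _ (hbI q), ?_⟩
  intro p hp z hz
  let f := algebraMap D (Localization.AtPrime p.asIdeal)
  have hdiv : ∀ q, ∃ t, f (b q) = f (b p) * t := fun q => hb p hp _ (hbI q)
  choose t ht using hdiv
  have hunit : IsUnit (f (c p) + ∑ q ∈ S.erase p, t q * f (c q)) := by
    by_contra hnu
    have hsum : ∑ q ∈ S.erase p, t q * f (c q) ∈
        IsLocalRing.maximalIdeal (Localization.AtPrime p.asIdeal) := by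
      refine Ideal.sum_mem _ fun q hq => Ideal.mul_mem_left _ _ ?_
      rw [Finset.mem_erase] at hq
      exact (IsLocalization.AtPrime.to_map_mem_maximal_iff _ p.asIdeal _).2
        ((hc q hq.2).2 p hp hq.1.symm)
    have hcp := (Ideal.add_mem_iff_left _ hsum).1 ((IsLocalRing.mem_maximalIdeal _).2 hnu)
    exact (hc p hp).1 ((IsLocalization.AtPrime.to_map_mem_maximal_iff _ p.asIdeal _).1 hcp)
  have hfactor : f (∑ q ∈ S, b q * c q) =
      f (b p) * (f (c p) + ∑ q ∈ S.erase p, t q * f (c q)) := by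
    rw [map_sum, ← Finset.add_sum_erase S _ hp, map_mul, mul_add, Finset.mul_sum]
    congr 1
    refine Finset.sum_congr rfl fun q _ => ?_
    rw [map_mul, ht q, mul_assoc]
  change f _ ∣ f z
  rw [hfactor, hunit.mul_right_dvd]
  exact hb p hp z hz

/-- In a Krull domain, any nonzero `a ∈ I` is completed by some `b ∈ I` to a pair with the same
divisorial closure as `I`. -/
theorem IsKrullDomain.exists_mem_forall_dvd_mul [IsKrullDomain D] {I : Ideal D} {a : D}
    (ha : a ∈ I) (ha0 : a ≠ 0) :
    ∃ b ∈ I, b ≠ 0 ∧ ∀ u w : D, w ≠ 0 → w ∣ u * a → w ∣ u * b → ∀ z ∈ I, w ∣ u * z := by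
  have hfin := IsKrullDomain.finite_character a ha0
  obtain ⟨b, hbI, hb⟩ : ∃ b ∈ I, b ≠ 0 ∧ ∀ p ∈ hfin.toFinset, ∀ z ∈ I,
      algebraMap D (Localization.AtPrime p.asIdeal) b ∣ algebraMap D _ z := by
    obtain ⟨b, hbI, hb⟩ := IsKrullDomain.exists_mem_forall_localization_dvd I hfin.toFinset
      fun q hq => (hfin.mem_toFinset.1 hq).1
    -- If `b = 0`, no height-one prime contains `a`, since zero would divide `a ≠ 0` there. The
    -- local condition is then vacuous and `a` itself serves.
    by_cases hb0 : b = 0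
    · refine ⟨a, ha, ha0, fun p hp => ?_⟩
      have h := hb p hp a ha
      rw [hb0, map_zero, zero_dvd_iff, map_eq_zero_iff _ (IsLocalization.injective _
        p.asIdeal.primeCompl_le_nonZeroDivisors)] at h
      exact absurd h ha0
    · exact ⟨b, hbI, hb0, hb⟩
  refine ⟨b, hbI, hb.1, fun u w hw hwa hwb z hz => ?_⟩
  refine IsKrullDomain.dvd_of_forall_localization_dvd hw fun p hp => ?_
  -- Where `a` lies in `p`, `b` generates `I` locally; elsewhere `a` is a local unit, so `w` already
  -- divides `u`.
  by_cases hap : a ∈ p.asIdeal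
  · refine (map_dvd _ hwb).trans ?_
    rw [map_mul, map_mul]
    exact mul_dvd_mul_left _ (hb.2 p (hfin.mem_toFinset.2 ⟨hp, hap⟩) z hz)
  · have hu := (IsLocalization.AtPrime.isUnit_to_map_iff
      (Localization.AtPrime p.asIdeal) p.asIdeal a).2 hap
    have h := map_dvd (algebraMap D (Localization.AtPrime p.asIdeal)) hwa
    rw [map_mul, hu.dvd_mul_right] at h
    rw [map_mul]
    exact h.mul_right _

end TwoGeneration

/-! ### Inverses of two-generated ideals -/

namespace FractionalIdeal

variable {D : Type*} [CommRing D] [IsDomain D] {K : Type*} [Field K] [Algebra D K]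
  [IsFractionRing D K]

theorem div_mul_algebraMap_mem_one_iff {u w z : D} (hw : w ≠ 0) :
    algebraMap D K u / algebraMap D K w * algebraMap D K z ∈ (1 : FractionalIdeal D⁰ K) ↔
      w ∣ u * z := by
  have hw' : algebraMap D K w ≠ 0 := by simpa using hw
  rw [mem_one_iff]
  constructor
  · rintro ⟨c, hc⟩
    refine ⟨c, IsFractionRing.injective D K ?_⟩
    rw [map_mul, map_mul, hc]
    field_simp
  · rintro ⟨c, hc⟩
    refine ⟨c, ?_⟩
    rw [div_mul_eq_mul_div, ← map_mul, hc, map_mul, mul_div_cancel_left₀ _ hw']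

theorem mul_inv_of_isUnit {U J : FractionalIdeal D⁰ K} (hU : IsUnit U) (hJ : J ≠ 0) :
    (U * J)⁻¹ = U⁻¹ * J⁻¹ := by
  have hcancel : U * U⁻¹ = 1 := (mul_inv_cancel_iff_isUnit K).2 hU
  refine eq_of_forall_le_iff fun A => ?_
  rw [le_inv_iff_mul_le_one (mul_ne_zero_of_ne_zero hU.ne_zero hJ), ← mul_assoc,
    ← le_inv_iff_mul_le_one hJ]
  constructor
  · intro h
    calc A = U⁻¹ * (A * U) := by rw [mul_left_comm, mul_comm U⁻¹, hcancel, mul_one]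
      _ ≤ U⁻¹ * J⁻¹ := by gcongr
  · intro h
    calc A * U ≤ U⁻¹ * J⁻¹ * U := by gcongr
      _ = J⁻¹ := by rw [mul_comm, ← mul_assoc, hcancel, one_mul]

theorem isUnit_spanSingleton {x : K} (hx : x ≠ 0) : IsUnit (spanSingleton D⁰ x) :=
  (mul_inv_cancel_iff_isUnit K).1 (spanSingleton_mul_inv K hx)

theorem coeIdeal_span_pair_ne_zero {a : D} (b : D) (ha : a ≠ 0) :
    ((Ideal.span {a, b} : Ideal D) : FractionalIdeal D⁰ K) ≠ 0 := by
  rw [coeIdeal_ne_zero]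
  intro h
  have : a ∈ Ideal.span {a, b} := Ideal.subset_span (by simp)
  rw [h] at this
  exact ha (by simpa using this)

theorem mem_inv_coeIdeal_span_pair {a b : D} (ha : a ≠ 0) {x : K} :
    x ∈ ((Ideal.span {a, b} : Ideal D) : FractionalIdeal D⁰ K)⁻¹ ↔
      x * algebraMap D K a ∈ (1 : FractionalIdeal D⁰ K) ∧
      x * algebraMap D K b ∈ (1 : FractionalIdeal D⁰ K) := by
  rw [mem_inv_iff (coeIdeal_span_pair_ne_zero b ha)]
  constructor
  · exact fun h => ⟨h _ (mem_coeIdeal_of_mem _ (Ideal.subset_span (by simp))),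
      h _ (mem_coeIdeal_of_mem _ (Ideal.subset_span (by simp)))⟩
  · rintro ⟨h1, h2⟩ y hy
    obtain ⟨y, hy', rfl⟩ := (mem_coeIdeal _).1 hy
    obtain ⟨r, s, rfl⟩ := Ideal.mem_span_pair.1 hy'
    rw [mem_one_iff] at h1 h2 ⊢
    obtain ⟨m, hm⟩ := h1
    obtain ⟨n, hn⟩ := h2
    refine ⟨r * m + s * n, ?_⟩
    simp only [map_add, map_mul, hm, hn]
    ring

/-- Both `xa` and `xb` lie in `D` exactly when `abx` is a common multiple of `a` and `b`. This turns
the `⋆`-condition on intersections into one on inverses. -/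
theorem inv_coeIdeal_span_pair {a b : D} (ha : a ≠ 0) (hb : b ≠ 0) :
    ((Ideal.span {a, b} : Ideal D) : FractionalIdeal D⁰ K)⁻¹ =
      spanSingleton D⁰ (algebraMap D K (a * b))⁻¹ *
        ((Ideal.span {a} ⊓ Ideal.span {b} : Ideal D) : FractionalIdeal D⁰ K) := by
  have ha' : algebraMap D K a ≠ 0 := by simpa using ha
  have hb' : algebraMap D K b ≠ 0 := by simpa using hb
  ext x
  rw [mem_inv_coeIdeal_span_pair ha, mem_singleton_mul]
  constructor
  · rintro ⟨h1, h2⟩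
    obtain ⟨m, hm⟩ := (mem_one_iff _).1 h1
    obtain ⟨n, hn⟩ := (mem_one_iff _).1 h2
    have hmn : b * m = a * n := IsFractionRing.injective D K (by
      rw [map_mul, map_mul, hm, hn]; ring)
    refine ⟨algebraMap D K (b * m), mem_coeIdeal_of_mem _ ⟨?_, ?_⟩, ?_⟩
    · exact Ideal.mem_span_singleton.2 ⟨n, hmn⟩
    · exact Ideal.mem_span_singleton.2 ⟨m, rfl⟩
    · rw [map_mul, map_mul, hm]
      field_simp
  · rintro ⟨y, hy, rfl⟩
    obtain ⟨t, ⟨hta, htb⟩, rfl⟩ := (mem_coeIdeal _).1 hy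
    obtain ⟨m, hm⟩ := Ideal.mem_span_singleton.1 hta
    obtain ⟨n, hn⟩ := Ideal.mem_span_singleton.1 htb
    rw [mem_one_iff, mem_one_iff]
    refine ⟨⟨n, ?_⟩, ⟨m, ?_⟩⟩
    · rw [hn, map_mul, map_mul]
      field_simp
    · rw [hm, map_mul, map_mul]
      field_simp

/-- In a Krull domain, inverses of ideals are inverses of two-generated ideals. -/
theorem exists_inv_coeIdeal_eq_inv_span_pair [IsKrullDomain D] {I : Ideal D} (hI : I ≠ ⊥) :
    ∃ a b : D, a ≠ 0 ∧ b ≠ 0 ∧ (I : FractionalIdeal D⁰ K)⁻¹ =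
      ((Ideal.span {a, b} : Ideal D) : FractionalIdeal D⁰ K)⁻¹ := by
  obtain ⟨a, ha, ha0⟩ := Submodule.exists_mem_ne_zero_of_ne_bot hI
  obtain ⟨b, hb, hb0, h⟩ := IsKrullDomain.exists_mem_forall_dvd_mul ha ha0
  refine ⟨a, b, ha0, hb0, ?_⟩
  ext x
  rw [mem_inv_coeIdeal_span_pair ha0, mem_inv_iff (coeIdeal_ne_zero.2 hI)]
  refine ⟨fun hx => ⟨hx _ (mem_coeIdeal_of_mem _ ha), hx _ (mem_coeIdeal_of_mem _ hb)⟩, ?_⟩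
  rintro ⟨hxa, hxb⟩ y hy
  obtain ⟨z, hz, rfl⟩ := (mem_coeIdeal _).1 hy
  obtain ⟨u, w, hw, rfl⟩ := IsFractionRing.div_surjective (A := D) x
  have hw0 := nonZeroDivisors.ne_zero hw
  rw [div_mul_algebraMap_mem_one_iff hw0] at hxa hxb ⊢
  exact h u w hw0 hxa hxb z hz

end FractionalIdeal

/-! ### Squares of divisorial ideals -/

section Star

variable {D : Type*} [CommRing D] [IsDomain D] {K : Type*} [Field K] [Algebra D K]
  [IsFractionRing D K]

open FractionalIdeal

theorem IsStarDomain.inv_coeIdeal_span_pair_mul_self (hD : IsStarDomain D) {a b : D}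
    (ha : a ≠ 0) (hb : b ≠ 0) :
    ((Ideal.span {a, b} : Ideal D) : FractionalIdeal D⁰ K)⁻¹ *
        ((Ideal.span {a, b} : Ideal D) : FractionalIdeal D⁰ K)⁻¹ =
      ((Ideal.span {a ^ 2, b ^ 2} : Ideal D) : FractionalIdeal D⁰ K)⁻¹ := by
  rw [inv_coeIdeal_span_pair ha hb, inv_coeIdeal_span_pair (pow_ne_zero 2 ha) (pow_ne_zero 2 hb),
    hD a b, coeIdeal_pow, mul_mul_mul_comm, spanSingleton_mul_spanSingleton, ← sq, ← sq,
    ← mul_pow, map_pow, inv_pow]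

/-- In a Krull `⋆`-domain, the square of a divisorial ideal is divisorial. -/
theorem DivisorialIdeal.val_mul_self_of_isStarDomain [IsKrullDomain D] (hD : IsStarDomain D)
    (I : DivisorialIdeal D K) : (I * I).val = I.val * I.val := by
  -- Denominators are cleared in `I⁻¹` rather than in `I`, because `I = (I⁻¹)⁻¹` must appear as an
  -- inverse.
  obtain ⟨c, J, hc, hJ⟩ := exists_eq_spanSingleton_mul I.val⁻¹
  have hc' : (algebraMap D K c)⁻¹ ≠ 0 := by simpa using hc
  have hJ0 : J ≠ ⊥ := by
    rintro rfl
    rw [coeIdeal_bot, mul_zero] at hJ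
    exact inv_ne_zero_of_ne_zero I.ne_zero hJ
  obtain ⟨a, b, ha, hb, hab⟩ := exists_inv_coeIdeal_eq_inv_span_pair (K := K) hJ0
  have hU := isUnit_spanSingleton (D := D) hc'
  set U := spanSingleton D⁰ (algebraMap D K c)⁻¹
  have hP := coeIdeal_span_pair_ne_zero (K := K) (b ^ 2) (pow_ne_zero 2 ha)
  have hI : I.val = U⁻¹ * ((Ideal.span {a, b} : Ideal D) : FractionalIdeal D⁰ K)⁻¹ := by
    rw [← hab, ← mul_inv_of_isUnit hU (coeIdeal_ne_zero.2 hJ0), ← hJ, I.inv_inv]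
  have hII : I.val * I.val =
      (U * (U * ((Ideal.span {a ^ 2, b ^ 2} : Ideal D) : FractionalIdeal D⁰ K)))⁻¹ := by
    rw [mul_inv_of_isUnit hU (mul_ne_zero_of_ne_zero hU.ne_zero hP), mul_inv_of_isUnit hU hP,
      ← hD.inv_coeIdeal_span_pair_mul_self ha hb, hI]
    ac_rfl
  rw [val_mul, hII, inv_inv_inv
    (mul_ne_zero_of_ne_zero hU.ne_zero (mul_ne_zero_of_ne_zero hU.ne_zero hP))]

end Star

theorem corollary72 (D : Type*) [CommRing D] [IsDomain D] [IsKrullDomain D]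
    (K : Type*) [Field K] [Algebra D K] [IsFractionRing D K]
    (hD : IsStarDomain D) (g : LocalClassGroup D K) :
    orderOf g ≠ 2 := by
  intro hg
  obtain ⟨hsq, hne⟩ := orderOf_eq_prime_iff.1 hg
  obtain ⟨I, rfl⟩ := QuotientGroup.mk_surjective g
  rw [sq, ← QuotientGroup.mk_mul, QuotientGroup.eq_one_iff] at hsq
  rw [Ne, QuotientGroup.eq_one_iff] at hne
  have hunit : IsUnit (I.val * I.val) := by
    rw [← I.val_mul_self_of_isStarDomain hD]
    exact hsq
  exact hne (isUnit_of_mul_isUnit_left hunit)
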